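/- **Conventions.** Let $n_1,n_2,n_3$ be positive integers. For $\mathcal A\in\mathbb C^{n_1\times n_2\times n_3}$ let $A^{(k)}=\mathcal A(:,:,k)$ be its frontal slices, $\overline{\mathcal A}$ the tensor obtained by applying the (unnormalized) discrete Fourier transform to every tube $\mathcal A(i,j,:)$, and $\mathrm{ifft}$ the inverse transform. The t-product $\mathcal A*\mathcal B$ is the tensor $\mathcal C$ with $\overline C^{(k)}=\overline A^{(k)}\,\overline B^{(k)}$ for all $k$. The conjugate transpose $\mathcal A^*$ has first slice $(A^{(1)})^*$ and $k$-th slice $(A^{(n_3+2-k)})^*$ for $k\ge 2$; the identity tensor $\mathcal I$ has first slice the identity matrix and all other slices zero; a real tensor $\mathcal Q\in\mathbb R^{n\times n\times n_3}$ is orthogonal if $\mathcal Q*\mathcal Q^*=\mathcal Q^**\mathcal Q=\mathcal I$. A t-SVD of $\mathcal A\in\mathbb R^{n_1\times n_2\times n_3}$ is a factorization $\mathcal A=\mathcal U*\mathcal S*\mathcal V^*$ into real tensors with $\mathcal U\in\mathbb R^{n_1\times n_1\times n_3}$ and $\mathcal V\in\mathbb R^{n_2\times n_2\times n_3}$ orthogonal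 and all frontal slices of $\mathcal S\in\mathbb R^{n_1\times n_2\times n_3}$ diagonal, where the diagonal entries $\overline{\mathcal S}_{iik}$, $1\le i\le\min(n_1,n_2)$, are real, nonnegative and nonincreasing in $i$ for each $k$. Thus $\overline{\mathcal S}_{iik}$ is the $i$-th largest singular value of $\overline A^{(k)}$ and depends only on $\mathcal A$. Write $\|\mathcal A\|_F^2=\sum_{ijk}|\mathcal A_{ijk}|^2$. For $\gamma>1$ let $\varphi_{1,\gamma}$ be either the SCAD penalty $$\varphi_{1,\gamma}(t)=\begin{cases}|t|,&|t|\le 1,\\ \dfrac{\gamma|t|-\frac12(t^2+1)}{\gamma-1},&1<|t|\le\gamma,\\ \dfrac{\gamma+1}2,&|t|>\gamma,\end{cases}$$ or the MCP penalty $$\varphi_{1,\gamma}(t)=\begin{cases}|t|-\dfrac{t^2}{2\gamma},&|t|<\gamma,\\ \dfrac{\gamma}{2},&|t|\ge\gamma,\end{cases}$$ and let $\varphi_{1,\gamma}'$ be the derivative of its restriction to $[0,\infty)$ (one-sided at $0$). For $\mathcal X,\mathcal X^{\mathrm{old}}\in\mathbb R^{n_1\times n_2\times n_3}$ with t-SVDs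 $\mathcal X=\mathcal U*\mathcal S*\mathcal V^*$ and $\mathcal X^{\mathrm{old}}=\mathcal U^{\mathrm{old}}*\mathcal S^{\mathrm{old}}*(\mathcal V^{\mathrm{old}})^*$ set $\|\mathcal X\|_\gamma=\frac1{n_3}\sum_{i,k}\varphi_{1,\gamma}(\overline{\mathcal S}_{iik})$ and $$Q_\gamma(\mathcal X|\mathcal X^{\mathrm{old}})=\|\mathcal X^{\mathrm{old}}\|_\gamma+\frac1{n_3}\sum_{i,k}\varphi_{1,\gamma}'(\overline{\mathcal S}^{\mathrm{old}}_{iik})\bigl(\overline{\mathcal S}_{iik}-\overline{\mathcal S}^{\mathrm{old}}_{iik}\bigr),$$ the sums being over $1\le i\le\min(n_1,n_2)$ and $1\le k\le n_3$. For $w,z\in\mathbb R$ let $\mathcal T_w(z)=\operatorname{sgn}(z)\max(|z|-w,0)$. For a t-SVD $\mathcal Y=\mathcal U*\mathcal R*\mathcal V^*$ of a real tensor $\mathcal Y$ and $\mathcal W\in\mathbb R^{n_1\times n_2\times n_3}$ put $\mathcal D_{\mathcal W}(\mathcal Y)=\mathcal U*\mathrm{ifft}(\mathcal T_{\mathcal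 W}(\overline{\mathcal R}))*\mathcal V^*$, where $\mathcal T_{\mathcal W}(\overline{\mathcal R})_{ijk}=\mathcal T_{\mathcal W_{ijk}}(\overline{\mathcal R}_{ijk})$. **Theorem (generalized t-SVT).** Let $\gamma>1$, $\mu>0$, let $\mathcal X^{\mathrm{old}},\mathcal Y\in\mathbb R^{n_1\times n_2\times n_3}$, and let $\mathcal W_{ijk}=\delta_i^j\,\varphi_{1,\gamma}'(\overline{\mathcal S}^{\mathrm{old}}_{iik})/\mu$. Then $\mathcal Y$ has a t-SVD, and for every t-SVD of $\mathcal Y$ the tensor $\mathcal D_{\mathcal W}(\mathcal Y)$ formed from it is real and is a minimizer of $$\mathcal X\longmapsto Q_\gamma(\mathcal X|\mathcal X^{\mathrm{old}})+\frac\mu2\|\mathcal X-\mathcal Y\|_F^2$$ over all $\mathcal X\in\mathbb R^{n_1\times n_2\times n_3}$. -/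

import Mathlib

namespace TensorSVT

/-! ### Three-way tensors, the tube-wise DFT and the t-product -/

/-- `m × n × p` tensors. The third index is cyclic; the frontal slices numbered `1, …, p` in
one-based notation are those of index `0, …, p - 1` here. -/
abbrev Tensor (𝕜 : Type) (m n p : ℕ) : Type := Fin m → Fin n → ZMod p → 𝕜

/-- A real tensor regarded as a complex one. -/
def toComplex {m n p : ℕ} (A : Tensor ℝ m n p) : Tensor ℂ m n p := fun i j k => (A i j k : ℂ)

/-- The discrete Fourier transform of every tube (unnormalized). -/
noncomputable def fft {m n p : ℕ} [NeZero p] (A : Tensor ℂ m n p) : Tensor ℂ m n p :=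
  fun i j => ZMod.dft (A i j)

/-- The inverse discrete Fourier transform of every tube (with the factor `1 / p`). -/
noncomputable def ifft {m n p : ℕ} [NeZero p] (A : Tensor ℂ m n p) : Tensor ℂ m n p :=
  fun i j => ZMod.dft.symm (A i j)

/-- The `k`-th frontal slice. -/
def slice {m n p : ℕ} (A : Tensor ℂ m n p) (k : ZMod p) : Matrix (Fin m) (Fin n) ℂ :=
  Matrix.of fun i j => A i j k

/-- The t-product: multiply the frontal slices in the Fourier domain and transform back. -/
noncomputable def tprod {m l n p : ℕ} [NeZero p] (A : Tensor ℂ m l p) (B : Tensor ℂ l n p) :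
    Tensor ℂ m n p :=
  ifft fun i j k => (slice (fft A) k * slice (fft B) k) i j

/-- The conjugate transpose: every frontal slice is conjugate-transposed and the order of the
slices `2, …, p` (one-based) is reversed. -/
noncomputable def conjT {m n p : ℕ} (A : Tensor ℂ m n p) : Tensor ℂ n m p :=
  fun i j k => star (A j i (-k))

/-- The identity tensor: the first frontal slice is the identity matrix, the others vanish. -/
def identity (n p : ℕ) : Tensor ℂ n n p := fun i j k => if i = j ∧ k = 0 then 1 else 0

/-- Orthogonal real tensors. -/
def IsOrthogonal {n p : ℕ} [NeZero p] (Q : Tensor ℝ n n p) : Prop :=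
  tprod (toComplex Q) (conjT (toComplex Q)) = identity n p ∧
    tprod (conjT (toComplex Q)) (toComplex Q) = identity n p

/-- Tensors all of whose frontal slices are diagonal. -/
def IsFDiagonal {m n p : ℕ} (S : Tensor ℝ m n p) : Prop :=
  ∀ (i : Fin m) (j : Fin n) (k : ZMod p), (i : ℕ) ≠ (j : ℕ) → S i j k = 0

/-- The `i`-th diagonal entry of the `k`-th frontal slice of the Fourier transform of `S`. -/
noncomputable def fourierDiag {m n p : ℕ} [NeZero p] (S : Tensor ℝ m n p) (i : Fin (min m n))
    (k : ZMod p) : ℂ :=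
  fft (toComplex S) (Fin.castLE (min_le_left m n) i) (Fin.castLE (min_le_right m n) i) k

/-- `A = U * S * V^*` is a t-SVD of the real tensor `A`: `U` and `V` are orthogonal, `S` is
f-diagonal, and in the Fourier domain every frontal slice of `S` carries singular values, that is,
nonnegative real numbers in nonincreasing order, on its diagonal. -/
structure IsTSVD {m n p : ℕ} [NeZero p] (A : Tensor ℝ m n p) (U : Tensor ℝ m m p)
    (S : Tensor ℝ m n p) (V : Tensor ℝ n n p) : Prop where
  orthogonal_left : IsOrthogonal U
  orthogonal_right : IsOrthogonal V
  fDiagonal : IsFDiagonal S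
  factorization :
    toComplex A = tprod (tprod (toComplex U) (toComplex S)) (conjT (toComplex V))
  real : ∀ i k, (fourierDiag S i k).im = 0
  nonneg : ∀ i k, 0 ≤ (fourierDiag S i k).re
  decreasing : ∀ k, Antitone fun i => (fourierDiag S i k).re

/-- The `i`-th largest singular value of the `k`-th frontal slice of the Fourier transform of
`A`. -/
noncomputable def fourierSV {m n p : ℕ} [NeZero p] (A : Tensor ℝ m n p) (i : ℕ) (k : ZMod p) : ℝ :=
  (Matrix.toEuclideanLin (slice (fft (toComplex A)) k)).singularValues i

/-! ### The diagonal of a t-SVD consists of the singular values -/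

theorem slice_fft_tprod {m l n p : ℕ} [NeZero p] (A : Tensor ℂ m l p) (B : Tensor ℂ l n p)
    (k : ZMod p) : slice (fft (tprod A B)) k = slice (fft A) k * slice (fft B) k := by
  ext i j
  simp [slice, fft, tprod, ifft]

theorem slice_fft_conjT {m n p : ℕ} [NeZero p] (A : Tensor ℂ m n p) (k : ZMod p) :
    slice (fft (conjT A)) k = (slice (fft A) k).conjTranspose := by
  ext i j
  simp only [slice, fft, conjT, ZMod.dft_apply, Matrix.of_apply, Matrix.conjTranspose_apply,
    star_sum, smul_eq_mul, star_mul']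
  refine Fintype.sum_equiv (Equiv.neg _) _ _ fun l => ?_
  have h := AddChar.map_neg_eq_conj (ZMod.stdAddChar (N := p)) (l * k)
  simp [h]

theorem slice_fft_identity (n : ℕ) {p : ℕ} [NeZero p] (k : ZMod p) :
    slice (fft (identity n p)) k = 1 := by
  ext i j
  by_cases h : i = j <;> simp [slice, fft, identity, ZMod.dft_apply, h, Matrix.one_apply]

/-- If `(U, S, V)` is a t-SVD of `A`, then the diagonal entries of the Fourier transform of `S` are
the singular values of the Fourier slices of `A`, so that quantities written with `fourierSV`
depend on `A` only and can be read off from any t-SVD. -/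
theorem IsTSVD.fourierDiag_eq {m n p : ℕ} [NeZero p] {A : Tensor ℝ m n p} {U : Tensor ℝ m m p}
    {S : Tensor ℝ m n p} {V : Tensor ℝ n n p} (h : IsTSVD A U S V) (i : Fin (min m n))
    (k : ZMod p) : fourierDiag S i k = (fourierSV A i k : ℂ) := by
  set M := slice (fft (toComplex A)) k with hM
  set U' := slice (fft (toComplex U)) k with hU'
  set S' := slice (fft (toComplex S)) k with hS'
  set V' := slice (fft (toComplex V)) k with hV'
  have hMf : M = U' * S' * V'.conjTranspose := by
    rw [hM, h.factorization, slice_fft_tprod, slice_fft_tprod, slice_fft_conjT]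
  have hU : U'.conjTranspose * U' = 1 := by
    rw [hU', ← slice_fft_conjT, ← slice_fft_tprod, h.orthogonal_left.2, slice_fft_identity]
  have hV : V'.conjTranspose * V' = 1 := by
    rw [hV', ← slice_fft_conjT, ← slice_fft_tprod, h.orthogonal_right.2, slice_fft_identity]
  have hoff : ∀ (a : Fin m) (b : Fin n), (a : ℕ) ≠ b → S' a b = 0 := by
    intro a b hab
    simp [hS', slice, fft, ZMod.dft_apply, toComplex, h.fDiagonal a b _ hab]
  have hdiag : ∀ (a : Fin m) (b : Fin n) (hab : (a : ℕ) = b),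
      S' a b = ((fourierDiag S ⟨b, lt_min (hab ▸ a.2) b.2⟩ k).re : ℂ) := by
    intro a b hab
    have : S' a b = fourierDiag S ⟨b, lt_min (hab ▸ a.2) b.2⟩ k := by
      obtain ⟨a, ha⟩ := a
      obtain ⟨b, hb⟩ := b
      obtain rfl : a = b := hab
      rfl
    rw [this]
    exact Complex.ext (by simp) (by simp [h.real])
  let d : Fin n → ℝ := fun b =>
    if hb : (b : ℕ) < min m n then (fourierDiag S ⟨b, hb⟩ k).re ^ 2 else 0
  have hd : Antitone d := by
    intro a b hab
    by_cases hb : (b : ℕ) < min m n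
    · have ha : (a : ℕ) < min m n := lt_of_le_of_lt hab hb
      simp only [d, ha, hb, dif_pos]
      exact pow_le_pow_left₀ (h.nonneg _ _)
        (h.decreasing k (show (⟨a, ha⟩ : Fin _) ≤ ⟨b, hb⟩ from hab)) 2
    · simp only [d, hb, dif_neg, not_false_eq_true]
      split_ifs <;> positivity
  have hSS : S'.conjTranspose * S' = Matrix.diagonal fun b => (d b : ℂ) := by
    ext a b
    rw [Matrix.mul_apply, Matrix.diagonal_apply]
    simp only [Matrix.conjTranspose_apply]
    by_cases hb : (b : ℕ) < min m n
    · have hbm : (b : ℕ) < m := lt_of_lt_of_le hb (min_le_left _ _)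
      rw [Finset.sum_eq_single (⟨b, hbm⟩ : Fin m)]
      · by_cases hab : a = b
        · subst hab
          rw [if_pos rfl, hdiag ⟨a, hbm⟩ a rfl]
          have hda : d a = (fourierDiag S ⟨a, hb⟩ k).re ^ 2 := dif_pos hb
          simp [hda, sq]
        · rw [if_neg hab, hoff ⟨b, hbm⟩ a (fun e => hab (Fin.ext e.symm))]
          simp
      · intro c _ hc
        rw [hoff c b (fun e => hc (Fin.ext e))]
        simp
      · simp
    · rw [Finset.sum_eq_zero]
      · split_ifs with hab
        · have hda : d a = 0 := dif_neg (hab ▸ hb)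
          simp [hda]
        · rfl
      · intro c _
        rw [hoff c b (fun e => hb (lt_min (e ▸ c.2) b.2))]
        simp
  have hchar : (M.conjTranspose * M).charpoly = (Matrix.diagonal fun b => (d b : ℂ)).charpoly := by
    have : M.conjTranspose * M = V' * ((S'.conjTranspose * S') * V'.conjTranspose) := by
      rw [hMf]
      simp only [Matrix.conjTranspose_mul, Matrix.conjTranspose_conjTranspose, Matrix.mul_assoc]
      rw [← Matrix.mul_assoc U'.conjTranspose, hU, Matrix.one_mul]
    rw [this, Matrix.charpoly_mul_comm, Matrix.mul_assoc, hV, Matrix.mul_one, hSS]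
  have hlin : (LinearMap.adjoint (Matrix.toEuclideanLin M) ∘ₗ Matrix.toEuclideanLin M).charpoly =
      (M.conjTranspose * M).charpoly := by
    rw [← Matrix.toEuclideanLin_conjTranspose_eq_adjoint]
    have : Matrix.toEuclideanLin M.conjTranspose ∘ₗ Matrix.toEuclideanLin M =
        Matrix.toEuclideanLin (M.conjTranspose * M) := (Matrix.toLpLin_mul _ _ _ _ _).symm
    rw [this, Matrix.toEuclideanLin_eq_toLin_orthonormal]
    exact Matrix.charpoly_toLin _ _
  have hn : Module.finrank ℂ (EuclideanSpace ℂ (Fin n)) = n := by simp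
  have heig :=
    (Matrix.toEuclideanLin M).isSymmetric_adjoint_comp_self.sort_roots_charpoly_eq_eigenvalues hn
  have hsort : (((Matrix.diagonal fun b => (d b : ℂ)).charpoly.roots).map RCLike.re).sort (· ≥ ·) =
      List.ofFn d := by
    rw [Matrix.charpoly_diagonal, Polynomial.roots_prod _ _ (by
      simp [Finset.prod_ne_zero_iff, Polynomial.X_sub_C_ne_zero])]
    simp only [Polynomial.roots_X_sub_C, Multiset.bind_singleton, Fin.univ_val_map,
      Multiset.map_coe, List.map_ofFn, Function.comp_def]
    rw [show (fun x => RCLike.re (d x : ℂ)) = d from funext fun x => Complex.ofReal_re _,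
      Multiset.coe_sort]
    apply List.mergeSort_of_pairwise
    simp_rw [decide_eq_true_eq, ← List.sortedGE_iff_pairwise]
    exact hd.sortedGE_ofFn
  rw [hlin, hchar, hsort, List.ofFn_inj] at heig
  have hin : (i : ℕ) < n := lt_of_lt_of_le i.2 (min_le_right _ _)
  have hsv := (Matrix.toEuclideanLin M).sq_singularValues_of_lt hn hin
  rw [← heig] at hsv
  simp only [d, i.2, dif_pos] at hsv
  have hre : (fourierDiag S i k).re = fourierSV A i k :=
    ((sq_eq_sq₀ (LinearMap.singularValues_nonneg _ _) (h.nonneg i k)).1 hsv).symm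
  rw [← hre]
  exact Complex.ext (by simp) (by simp [h.real])

/-! ### The SCAD and MCP penalties -/

/-- The two penalty families. -/
inductive Penalty : Type
  | scad
  | mcp

/-- The penalty function `φ_{lam,γ}`. -/
noncomputable def Penalty.phi : Penalty → ℝ → ℝ → ℝ → ℝ
  | .scad, lam, γ, t =>
      if |t| ≤ lam then lam * |t|
      else if |t| ≤ γ * lam then (γ * lam * |t| - (t ^ 2 + lam ^ 2) / 2) / (γ - 1)
      else (γ + 1) / 2 * lam ^ 2
  | .mcp, lam, γ, t =>
      if |t| < γ * lam then lam * |t| - t ^ 2 / (2 * γ) else γ * lam ^ 2 / 2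

/-- The derivative of `φ_{lam,γ}` restricted to `[0, ∞)`; one-sided at `0`, where the even function
`φ_{lam,γ}` has a kink. -/
noncomputable def Penalty.dphi (P : Penalty) (lam γ t : ℝ) : ℝ :=
  derivWithin (P.phi lam γ) (Set.Ici 0) t

/-! ### The γ-norm, its majorant, and the thresholding operators -/

/-- The Frobenius norm. -/
noncomputable def frobenius {m n p : ℕ} [NeZero p] (A : Tensor ℝ m n p) : ℝ :=
  √(∑ i, ∑ j, ∑ k, |A i j k| ^ 2)

/-- The γ-norm `‖A‖_γ`. -/
noncomputable def gammaNorm {m n p : ℕ} [NeZero p] (P : Penalty) (γ : ℝ) (A : Tensor ℝ m n p) : ℝ :=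
  1 / (p : ℝ) * ∑ i : Fin (min m n), ∑ k : ZMod p, P.phi 1 γ (fourierSV A i k)

/-- The majorant `Q_γ(X | Xold)`. -/
noncomputable def majorant {m n p : ℕ} [NeZero p] (P : Penalty) (γ : ℝ)
    (X Xold : Tensor ℝ m n p) : ℝ :=
  gammaNorm P γ Xold +
    1 / (p : ℝ) * ∑ i : Fin (min m n), ∑ k : ZMod p,
      P.dphi 1 γ (fourierSV Xold i k) * (fourierSV X i k - fourierSV Xold i k)

/-- Soft thresholding `sgn(z) [|z| - w]₊`. -/
noncomputable def softThreshold (w z : ℝ) : ℝ := Real.sign z * max (|z| - w) 0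

/-- Entrywise soft thresholding with a tensor `W` of thresholds. -/
noncomputable def softThresholdTensor {m n p : ℕ} (W X : Tensor ℝ m n p) : Tensor ℝ m n p :=
  fun i j k => softThreshold (W i j k) (X i j k)

/-- The generalized t-SVT `U * ifft(T_W(fft S)) * V^*`, formed from a t-SVD `(U, S, V)`; for a t-SVD
the entries of `fft S` are real, so that passing to real parts changes nothing. -/
noncomputable def generalizedTSVT {m n p : ℕ} [NeZero p] (W : Tensor ℝ m n p) (U : Tensor ℝ m m p)
    (S : Tensor ℝ m n p) (V : Tensor ℝ n n p) : Tensor ℂ m n p :=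
  tprod
    (tprod (toComplex U)
      (ifft (toComplex (softThresholdTensor W fun i j k => (fft (toComplex S) i j k).re))))
    (conjT (toComplex V))

/-- The weights `W_{ijk} = δ_i^j φ'_{1,γ}(σ_i(k-th Fourier slice of Xold)) / μ`. -/
noncomputable def svtWeight {m n p : ℕ} [NeZero p] (P : Penalty) (γ μ : ℝ)
    (Xold : Tensor ℝ m n p) : Tensor ℝ m n p :=
  fun i j k => if (i : ℕ) = (j : ℕ) then P.dphi 1 γ (fourierSV Xold i k) / μ else 0

end TensorSVT

namespace TensorSVT

/-! ### The singular value decomposition of a matrix -/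

/-! The Fourier transform splits the problem into one matrix problem per frequency. By Parseval
(`frobenius_sub_sq`) the squared distance to `Y` is the average over `k` of the squared distances of
the Fourier slices, and the majorant is, up to a constant, the average of weighted sums of singular
values of those slices.

For one slice, von Neumann's trace inequality gives ‖A - B‖² ≥ ∑ (σᵢ(A) - σᵢ(B))². So the objective
is bounded below by a sum of scalar problems w x + (x - y)²/2 over x ≥ 0, each solved by max (y - w)
0 (`max_sub_isMin`). The bound is attained by a matrix with the singular vectors of the slice of `Y`
and the thresholded values on the diagonal, provided these values are still nonincreasing. This is
where concavity of the penalty enters: its derivative is nonincreasing on [0, ∞)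
(`dphi_antitoneOn`), so smaller singular values of `Xold` carry larger weights.

Real tensors correspond to families of slices with F (-k) = conj (F k). The thresholded slices keep
this symmetry because singular values do not change under conjugation. For the existence of a t-SVD,
the slicewise decompositions are chosen compatibly with conjugation (`exists_equivariant`). -/

/-- The rectangular diagonal matrix with diagonal entries `s 0, s 1, …`. -/
def rectDiagonal (𝕜 : Type*) [RCLike 𝕜] (m n : ℕ) (s : ℕ → ℝ) : Matrix (Fin m) (Fin n) 𝕜 :=
  Matrix.of fun i j => if (i : ℕ) = (j : ℕ) then (s i : 𝕜) else 0

theorem inner_map_eigenvectorBasis {𝕜 E F : Type*} [RCLike 𝕜] [NormedAddCommGroup E]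
    [InnerProductSpace 𝕜 E] [FiniteDimensional 𝕜 E] [NormedAddCommGroup F] [InnerProductSpace 𝕜 F]
    [FiniteDimensional 𝕜 F] (T : E →ₗ[𝕜] F) {n : ℕ} (hn : Module.finrank 𝕜 E = n) (i j : Fin n) :
    inner 𝕜 (T (T.isSymmetric_adjoint_comp_self.eigenvectorBasis hn i))
      (T (T.isSymmetric_adjoint_comp_self.eigenvectorBasis hn j)) =
      if i = j then ((T.singularValues j ^ 2 : ℝ) : 𝕜) else 0 := by
  rw [← LinearMap.adjoint_inner_right, ← LinearMap.comp_apply,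
    T.isSymmetric_adjoint_comp_self.apply_eigenvectorBasis hn j, inner_smul_right,
    OrthonormalBasis.inner_eq_ite, T.sq_singularValues_fin hn]
  simp

/-- A linear map between finite-dimensional inner product spaces is diagonal, with its singular
values on the diagonal, for suitable orthonormal bases. -/
theorem exists_orthonormalBasis_singularValues {𝕜 E F : Type*} [RCLike 𝕜] [NormedAddCommGroup E]
    [InnerProductSpace 𝕜 E] [FiniteDimensional 𝕜 E] [NormedAddCommGroup F] [InnerProductSpace 𝕜 F]
    [FiniteDimensional 𝕜 F] (T : E →ₗ[𝕜] F) {m n : ℕ} (hn : Module.finrank 𝕜 E = n)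
    (hm : Module.finrank 𝕜 F = m) :
    ∃ (v : OrthonormalBasis (Fin n) 𝕜 E) (u : OrthonormalBasis (Fin m) 𝕜 F), ∀ j : Fin n,
      T (v j) = ∑ i : Fin m, rectDiagonal 𝕜 m n T.singularValues i j • u i := by
  set v := T.isSymmetric_adjoint_comp_self.eigenvectorBasis hn with hv
  -- Candidate left singular vectors, orthonormal on the set `s` of indices with nonzero singular
  -- value. Values off `s` play no role, since the basis `u` below extends only the restriction to
  -- `s`.
  let w : Fin m → F := fun i =>
    if h : (i : ℕ) < n then ((T.singularValues i : ℝ) : 𝕜)⁻¹ • T (v ⟨i, h⟩) else 0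
  let s : Set (Fin m) := {i | T.singularValues i ≠ 0}
  have hs : ∀ i ∈ s, (i : ℕ) < n := by
    intro i hi
    by_contra h
    exact hi (T.singularValues_of_finrank_le (by omega))
  have hww : ∀ i ∈ s, ∀ j ∈ s, inner 𝕜 (w i) (w j) = if i = j then 1 else 0 := by
    intro i hi j hj
    simp only [w, dif_pos (hs i hi), dif_pos (hs j hj), inner_smul_left,
      inner_smul_right, hv, inner_map_eigenvectorBasis, Fin.ext_iff]
    have hj' : ((T.singularValues j : ℝ) : 𝕜) ≠ 0 := by simpa [s] using hj
    split_ifs with h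
    · simp only [h, map_inv₀, RCLike.conj_ofReal, RCLike.ofReal_pow]
      field_simp
    · simp
  have hw : Orthonormal 𝕜 (s.domRestrict w) := by
    rw [orthonormal_iff_ite]
    rintro ⟨i, hi⟩ ⟨j, hj⟩
    simpa [Subtype.ext_iff] using hww i hi j hj
  obtain ⟨u, hu⟩ := hw.exists_orthonormalBasis_extension_of_card_eq (by simpa using hm)
  refine ⟨v, u, fun j => ?_⟩
  by_cases hj : T.singularValues j = 0
  · have h0 : T (v j) = 0 := by
      rw [← inner_self_eq_zero (𝕜 := 𝕜), hv, inner_map_eigenvectorBasis]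
      simp [hj]
    rw [h0, Finset.sum_eq_zero]
    intro i _
    simp only [rectDiagonal, Matrix.of_apply]
    split_ifs with h
    · simp [h, hj]
    · simp
  · have hjm : (j : ℕ) < m := by
      have h1 := T.singularValues_pos_iff_lt_finrank_range.1
        ((T.singularValues_pos_iff_ne_zero _).2 hj)
      exact h1.trans_le (hm ▸ Submodule.finrank_le _)
    rw [Finset.sum_eq_single (⟨j, hjm⟩ : Fin m)]
    · rw [hu ⟨j, hjm⟩ hj]
      have hj' : ((T.singularValues j : ℝ) : 𝕜) ≠ 0 := by simpa using hj
      simp [rectDiagonal, w, smul_smul, hj']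
    · intro i _ hi
      have : (i : ℕ) ≠ j := fun h => hi (Fin.ext h)
      simp [rectDiagonal, this]
    · simp

/-- `A = U * diag(s) * V^*` is a singular value decomposition. -/
structure IsSVD {𝕜 : Type*} [RCLike 𝕜] {m n : ℕ} (A : Matrix (Fin m) (Fin n) 𝕜)
    (U : Matrix (Fin m) (Fin m) 𝕜) (s : ℕ → ℝ) (V : Matrix (Fin n) (Fin n) 𝕜) : Prop where
  left_mem : U ∈ Matrix.unitaryGroup (Fin m) 𝕜
  right_mem : V ∈ Matrix.unitaryGroup (Fin n) 𝕜
  antitone : Antitone s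
  nonneg : ∀ i, 0 ≤ s i
  eq_mul : A = U * rectDiagonal 𝕜 m n s * V.conjTranspose

/-- Stated over any `RCLike` field because frequencies with -k = k need a real decomposition of a
real slice, the others a complex one. -/
theorem exists_isSVD {𝕜 : Type*} [RCLike 𝕜] {m n : ℕ} (A : Matrix (Fin m) (Fin n) 𝕜) :
    ∃ U s V, IsSVD A U s V := by
  let T := Matrix.toEuclideanLin A
  obtain ⟨v, u, h⟩ := exists_orthonormalBasis_singularValues T (m := m) (n := n) (by simp) (by simp)
  let U := (EuclideanSpace.basisFun (Fin m) 𝕜).toBasis.toMatrix u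
  let V := (EuclideanSpace.basisFun (Fin n) 𝕜).toBasis.toMatrix v
  have hU : U ∈ Matrix.unitaryGroup (Fin m) 𝕜 :=
    (EuclideanSpace.basisFun (Fin m) 𝕜).toMatrix_orthonormalBasis_mem_unitary u
  have hV : V ∈ Matrix.unitaryGroup (Fin n) 𝕜 :=
    (EuclideanSpace.basisFun (Fin n) 𝕜).toMatrix_orthonormalBasis_mem_unitary v
  refine ⟨U, T.singularValues, V, hU, hV, T.singularValues_antitone, T.singularValues_nonneg, ?_⟩
  have hAV : A * V = U * rectDiagonal 𝕜 m n T.singularValues := by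
    ext a j
    have h1 := congrArg (fun x : EuclideanSpace 𝕜 (Fin m) => x a) (h j)
    simp only [T, Matrix.toLpLin_apply, WithLp.ofLp_sum, Finset.sum_apply, PiLp.smul_apply,
      smul_eq_mul, Matrix.mulVec, dotProduct] at h1
    simp only [Matrix.mul_apply, V, U, Module.Basis.toMatrix_apply,
      OrthonormalBasis.coe_toBasis_repr_apply, EuclideanSpace.basisFun_repr]
    rw [h1]
    exact Finset.sum_congr rfl fun i _ => mul_comm _ _
  rw [← hAV, Matrix.mul_assoc, ← Matrix.star_eq_conjTranspose, Matrix.mem_unitaryGroup_iff.1 hV,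
    Matrix.mul_one]

theorem map_mem_unitaryGroup {𝕜 𝕜' : Type*} [RCLike 𝕜] [RCLike 𝕜'] {m : ℕ} {φ : 𝕜 →+* 𝕜'}
    (hφ : ∀ x, φ (star x) = star (φ x)) {U : Matrix (Fin m) (Fin m) 𝕜}
    (hU : U ∈ Matrix.unitaryGroup (Fin m) 𝕜) : U.map φ ∈ Matrix.unitaryGroup (Fin m) 𝕜' := by
  rw [Matrix.mem_unitaryGroup_iff, Matrix.star_eq_conjTranspose] at hU ⊢
  have h := congrArg (fun B => B.map φ) hU
  simp only [Matrix.map_mul] at h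
  rw [← Matrix.conjTranspose_map _ hφ, h]
  exact Matrix.map_one _ (map_zero φ) (map_one φ)

/-- Serves two maps: conjugation of ℂ, relating the frequencies k and -k, and the inclusion of ℝ in
ℂ. -/
theorem IsSVD.map {𝕜 𝕜' : Type*} [RCLike 𝕜] [RCLike 𝕜'] {m n : ℕ}
    {A : Matrix (Fin m) (Fin n) 𝕜} {U : Matrix (Fin m) (Fin m) 𝕜} {s : ℕ → ℝ}
    {V : Matrix (Fin n) (Fin n) 𝕜} (h : IsSVD A U s V) {φ : 𝕜 →+* 𝕜'}
    (hφ : ∀ x, φ (star x) = star (φ x)) (hr : ∀ r : ℝ, φ r = r) :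
    IsSVD (A.map φ) (U.map φ) s (V.map φ) where
  left_mem := map_mem_unitaryGroup hφ h.left_mem
  right_mem := map_mem_unitaryGroup hφ h.right_mem
  antitone := h.antitone
  nonneg := h.nonneg
  eq_mul := by
    have hd : (rectDiagonal 𝕜 m n s).map φ = rectDiagonal 𝕜' m n s := by
      ext i j
      simp only [rectDiagonal, Matrix.map_apply, Matrix.of_apply]
      split_ifs
      exacts [hr _, map_zero φ]
    rw [h.eq_mul, Matrix.map_mul, Matrix.map_mul, hd, Matrix.conjTranspose_map _ hφ]

/-! ### Von Neumann's trace inequality -/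

/-- Abel summation in inductive form. Keeping the factor `s r` on the right, instead of the bound 0,
lets the induction close without any sign condition on `s`. -/
theorem sum_mul_le_of_sum_le {e s : ℕ → ℝ} (hs : Antitone s)
    (he : ∀ a, ∑ i ∈ Finset.range a, e i ≤ 0)
    (r : ℕ) : ∑ i ∈ Finset.range r, s i * e i ≤ s r * ∑ i ∈ Finset.range r, e i := by
  induction r with
  | zero => simp
  | succ r ih =>
    rw [Finset.sum_range_succ]
    calc _ ≤ s r * ∑ i ∈ Finset.range r, e i + s r * e r := by gcongr
      _ = s r * ∑ i ∈ Finset.range (r + 1), e i := by rw [Finset.sum_range_succ, mul_add]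
      _ ≤ _ := mul_le_mul_of_nonpos_right (hs r.le_succ) (he _)

/-- Bathtub principle: mass at most `a` with density at most 1 pairs best with a nonincreasing `t`
when it fills the first `a` places. Termwise, t j - t a and q j - 1_{j < a} have opposite signs; the
total mass is compared at level t a ≥ 0. -/
theorem sum_mul_le_sum_range {r a : ℕ} (har : a ≤ r) {t q : ℕ → ℝ} (ht : Antitone t)
    (ht0 : ∀ i, 0 ≤ t i) (hq0 : ∀ i, 0 ≤ q i) (hq1 : ∀ i, q i ≤ 1)
    (hq : ∑ j ∈ Finset.range r, q j ≤ a) :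
    ∑ j ∈ Finset.range r, q j * t j ≤ ∑ j ∈ Finset.range a, t j := by
  have h1 : ∑ j ∈ Finset.range r, (t j - t a) * (q j - if j < a then 1 else 0) ≤ 0 := by
    refine Finset.sum_nonpos fun j _ => ?_
    split_ifs with h
    · exact mul_nonpos_of_nonneg_of_nonpos (sub_nonneg.2 (ht h.le)) (by linarith [hq1 j])
    · exact mul_nonpos_of_nonpos_of_nonneg (sub_nonpos.2 (ht (not_lt.1 h))) (by linarith [hq0 j])
  have h2 : ∀ f : ℕ → ℝ, ∑ j ∈ Finset.range r, f j * (if j < a then 1 else 0) =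
      ∑ j ∈ Finset.range a, f j := by
    intro f
    simp only [mul_ite, mul_one, mul_zero, ← Finset.sum_filter]
    congr 1
    ext j
    simp only [Finset.mem_filter, Finset.mem_range]
    omega
  have h3 := h2 t
  have h4 := h2 fun _ => t a
  simp only [sub_mul, mul_sub, Finset.sum_sub_distrib, h3, h4, ← Finset.mul_sum, Finset.sum_const,
    Finset.card_range, nsmul_eq_mul] at h1
  have h5 := mul_le_mul_of_nonneg_left hq (ht0 a)
  simp only [mul_comm (q _)]
  linarith

/-- A doubly substochastic matrix does not increase the pairing of two nonincreasing nonnegative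
sequences. -/
theorem sum_substochastic_le {r : ℕ} {s t : ℕ → ℝ} (hs : Antitone s) (hs0 : ∀ i, 0 ≤ s i)
    (ht : Antitone t) (ht0 : ∀ i, 0 ≤ t i) {M : Fin r → Fin r → ℝ} (hM : ∀ i j, 0 ≤ M i j)
    (hrow : ∀ i, ∑ j, M i j ≤ 1) (hcol : ∀ j, ∑ i, M i j ≤ 1) :
    ∑ i : Fin r, ∑ j : Fin r, s i * t j * M i j ≤ ∑ i : Fin r, s i * t i := by
  -- Extension by zero, so that partial sums over `Finset.range` make sense.
  let N : ℕ → ℕ → ℝ := fun i j => if h : i < r ∧ j < r then M ⟨i, h.1⟩ ⟨j, h.2⟩ else 0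
  have hMN : ∀ i j : Fin r, M i j = N i j := fun i j => by simp [N]
  have hN : ∀ i j, 0 ≤ N i j := by
    intro i j
    simp only [N]
    split_ifs
    exacts [hM _ _, le_rfl]
  have hNrow : ∀ i, ∑ j ∈ Finset.range r, N i j ≤ 1 := by
    intro i
    rw [Finset.sum_range]
    by_cases hi : i < r
    · simpa [← hMN ⟨i, hi⟩] using hrow ⟨i, hi⟩
    · simp [N, hi]
  have hNcol : ∀ j, ∑ i ∈ Finset.range r, N i j ≤ 1 := by
    intro j
    rw [Finset.sum_range]
    by_cases hj : j < r
    · simpa [← fun i => hMN i ⟨j, hj⟩] using hcol ⟨j, hj⟩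
    · simp [N, hj]
  have hNcol' : ∀ a j, ∑ i ∈ Finset.range a, N i j ≤ 1 := by
    intro a j
    refine le_trans ?_ (hNcol j)
    rcases le_total a r with h | h
    · exact Finset.sum_le_sum_of_subset_of_nonneg (Finset.range_mono h) fun _ _ _ => hN _ _
    · refine le_of_eq (Finset.sum_subset (Finset.range_mono h) ?_).symm
      intro i _ hi
      have : ¬ i < r := by simpa using hi
      simp [N, this]
  -- The defect (N t - t) i. Its partial sums are nonpositive by the bathtub principle, applied to
  -- the partial column sums of `N`; Abel summation against `s` then concludes.
  let e : ℕ → ℝ := fun i => if i < r then ∑ j ∈ Finset.range r, N i j * t j - t i else 0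
  have he' : ∀ a ≤ r, ∑ i ∈ Finset.range a, e i ≤ 0 := by
    intro a har
    have h1 : ∑ i ∈ Finset.range a, e i =
        ∑ j ∈ Finset.range r, (∑ i ∈ Finset.range a, N i j) * t j -
          ∑ i ∈ Finset.range a, t i := by
      simp only [Finset.sum_mul]
      rw [Finset.sum_comm, ← Finset.sum_sub_distrib]
      refine Finset.sum_congr rfl fun i hi => ?_
      have : i < r := (Finset.mem_range.1 hi).trans_le har
      simp [e, this]
    rw [h1, sub_nonpos]
    refine sum_mul_le_sum_range har ht ht0 (fun _ => Finset.sum_nonneg fun _ _ => hN _ _)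
      (hNcol' a) ?_
    rw [Finset.sum_comm]
    calc _ ≤ ∑ _i ∈ Finset.range a, (1 : ℝ) := Finset.sum_le_sum fun i _ => hNrow i
      _ = a := by simp
  have he : ∀ a, ∑ i ∈ Finset.range a, e i ≤ 0 := by
    intro a
    rcases le_total a r with h | h
    · exact he' a h
    · rw [← Finset.sum_subset (Finset.range_mono h)]
      · exact he' r le_rfl
      · intro i _ hi
        have : ¬ i < r := by simpa using hi
        simp [e, this]
  have h := (sum_mul_le_of_sum_le hs he r).trans
    (mul_nonpos_of_nonneg_of_nonpos (hs0 r) (he r))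
  have h2 : ∑ i ∈ Finset.range r, s i * e i =
      ∑ i : Fin r, ∑ j : Fin r, s i * t j * M i j - ∑ i : Fin r, s i * t i := by
    rw [Finset.sum_range, ← Finset.sum_sub_distrib]
    refine Finset.sum_congr rfl fun i _ => ?_
    simp only [e, i.2, if_true, mul_sub, Finset.sum_range, Finset.mul_sum, hMN]
    congr 1
    exact Finset.sum_congr rfl fun j _ => by ring
  linarith

theorem sum_normSq_row_of_mem_unitaryGroup {m : ℕ} {P : Matrix (Fin m) (Fin m) ℂ}
    (hP : P ∈ Matrix.unitaryGroup (Fin m) ℂ) (i : Fin m) : ∑ j, Complex.normSq (P i j) = 1 := by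
  have h := congrFun (congrFun (Matrix.mem_unitaryGroup_iff.1 hP) i) i
  rw [Matrix.mul_apply, Matrix.one_apply_eq] at h
  simp only [Matrix.star_apply, RCLike.star_def, Complex.mul_conj] at h
  exact_mod_cast h

theorem sum_normSq_col_of_mem_unitaryGroup {m : ℕ} {P : Matrix (Fin m) (Fin m) ℂ}
    (hP : P ∈ Matrix.unitaryGroup (Fin m) ℂ) (j : Fin m) : ∑ i, Complex.normSq (P i j) = 1 := by
  have h := sum_normSq_row_of_mem_unitaryGroup (Unitary.star_mem hP) j
  simpa [Matrix.star_apply, Complex.normSq_conj] using h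

theorem sum_castLE_le {r m : ℕ} (h : r ≤ m) {f : Fin m → ℝ} (hf : ∀ i, 0 ≤ f i) :
    ∑ i : Fin r, f (Fin.castLE h i) ≤ ∑ i, f i := by
  have h1 := Finset.sum_map Finset.univ (Fin.castLEEmb h) f
  simp only [Fin.castLEEmb_apply] at h1
  rw [← h1]
  exact Finset.sum_le_univ_sum_of_nonneg hf

theorem sum_rectDiagonal_mul {m n : ℕ} (s : ℕ → ℝ) (g : Fin m → Fin n → ℂ) :
    ∑ a, ∑ b, rectDiagonal ℂ m n s a b * g a b = ∑ i : Fin (min m n),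
      (s i : ℂ) * g (Fin.castLE (min_le_left m n) i) (Fin.castLE (min_le_right m n) i) := by
  rw [← Finset.sum_product' (f := fun a b => rectDiagonal ℂ m n s a b * g a b)]
  symm
  refine Finset.sum_of_injOn
    (fun i => (Fin.castLE (min_le_left m n) i, Fin.castLE (min_le_right m n) i)) ?_ ?_ ?_ ?_
  · intro i _ j _ h
    simpa [Fin.ext_iff] using h
  · simp
  · rintro ⟨a, b⟩ _ h
    have : (a : ℕ) ≠ b := by
      intro hab
      refine h ⟨⟨a, lt_min a.2 (hab ▸ b.2)⟩, by simp, ?_⟩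
      simp [Fin.ext_iff, hab]
    simp [rectDiagonal, this]
  · intro i _
    simp [rectDiagonal]

/-- The trace expands to ∑ s i t j P i j conj (Q i j), and Re (z conj w) ≤ (|z|² + |w|²)/2. Squared
moduli of a unitary matrix have row and column sums 1, so the average of the two truncated blocks is
doubly substochastic. -/
theorem re_trace_rectDiagonal_le {m n : ℕ} {P : Matrix (Fin m) (Fin m) ℂ}
    {Q : Matrix (Fin n) (Fin n) ℂ} (hP : P ∈ Matrix.unitaryGroup (Fin m) ℂ)
    (hQ : Q ∈ Matrix.unitaryGroup (Fin n) ℂ) {s t : ℕ → ℝ} (hs : Antitone s) (hs0 : ∀ i, 0 ≤ s i)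
    (ht : Antitone t) (ht0 : ∀ i, 0 ≤ t i) :
    ((rectDiagonal ℂ m n s).conjTranspose * (P * rectDiagonal ℂ m n t * Q.conjTranspose)).trace.re ≤
      ∑ i : Fin (min m n), s i * t i := by
  let p : Fin (min m n) → Fin m := Fin.castLE (min_le_left m n)
  let q : Fin (min m n) → Fin n := Fin.castLE (min_le_right m n)
  have htr : ((rectDiagonal ℂ m n s).conjTranspose *
      (P * rectDiagonal ℂ m n t * Q.conjTranspose)).trace =
      ∑ i : Fin (min m n), (s i : ℂ) * ∑ j : Fin (min m n), (t j : ℂ) * (P (p i) (p j) * star (Q (q i) (q j))) := by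
    have h1 : ∀ a b, (P * rectDiagonal ℂ m n t * Q.conjTranspose) a b =
        ∑ j : Fin (min m n), (t j : ℂ) * (P a (p j) * star (Q b (q j))) := by
      intro a b
      rw [← sum_rectDiagonal_mul t fun c d => P a c * star (Q b d)]
      simp only [Matrix.mul_apply, Finset.sum_mul, Matrix.conjTranspose_apply]
      rw [Finset.sum_comm]
      exact Finset.sum_congr rfl fun c _ => Finset.sum_congr rfl fun d _ => by ring
    simp only [← h1]
    rw [← sum_rectDiagonal_mul s fun a b => (P * rectDiagonal ℂ m n t * Q.conjTranspose) a b]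
    simp only [Matrix.trace, Matrix.diag_apply]
    simp only [Matrix.mul_apply (M := (rectDiagonal ℂ m n s).conjTranspose)]
    rw [Finset.sum_comm]
    refine Finset.sum_congr rfl fun a _ => Finset.sum_congr rfl fun b _ => ?_
    congr 1
    simp only [rectDiagonal, Matrix.conjTranspose_apply, Matrix.of_apply]
    split_ifs <;> simp
  rw [htr]
  refine le_trans ?_ (sum_substochastic_le hs hs0 ht ht0 (M := fun i j =>
    (Complex.normSq (P (p i) (p j)) + Complex.normSq (Q (q i) (q j))) / 2) ?_ ?_ ?_)
  · simp only [Complex.re_sum, Finset.mul_sum]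
    refine Finset.sum_le_sum fun i _ => Finset.sum_le_sum fun j _ => ?_
    have h2 : ((s i : ℂ) * ((t j : ℂ) * (P (p i) (p j) * star (Q (q i) (q j))))).re =
        s i * t j * (P (p i) (p j) * star (Q (q i) (q j))).re := by
      rw [Complex.re_ofReal_mul, Complex.re_ofReal_mul, mul_assoc]
    rw [h2]
    refine mul_le_mul_of_nonneg_left ?_ (mul_nonneg (hs0 _) (ht0 _))
    simp only [Complex.mul_re, RCLike.star_def, Complex.conj_re, Complex.conj_im,
      Complex.normSq_apply]
    nlinarith [sq_nonneg ((P (p i) (p j)).re - (Q (q i) (q j)).re),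
      sq_nonneg ((P (p i) (p j)).im - (Q (q i) (q j)).im)]
  · intro i j
    have := Complex.normSq_nonneg (P (p i) (p j))
    have := Complex.normSq_nonneg (Q (q i) (q j))
    positivity
  · intro i
    rw [← Finset.sum_div, Finset.sum_add_distrib]
    have h1 := sum_castLE_le (min_le_left m n) (f := fun b => Complex.normSq (P (p i) b))
      fun _ => Complex.normSq_nonneg _
    have h2 := sum_castLE_le (min_le_right m n) (f := fun b => Complex.normSq (Q (q i) b))
      fun _ => Complex.normSq_nonneg _
    rw [sum_normSq_row_of_mem_unitaryGroup hP] at h1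
    rw [sum_normSq_row_of_mem_unitaryGroup hQ] at h2
    simp only [p, q] at h1 h2 ⊢
    linarith
  · intro j
    rw [← Finset.sum_div, Finset.sum_add_distrib]
    have h1 := sum_castLE_le (min_le_left m n) (f := fun b => Complex.normSq (P b (p j)))
      fun _ => Complex.normSq_nonneg _
    have h2 := sum_castLE_le (min_le_right m n) (f := fun b => Complex.normSq (Q b (q j)))
      fun _ => Complex.normSq_nonneg _
    rw [sum_normSq_col_of_mem_unitaryGroup hP] at h1
    rw [sum_normSq_col_of_mem_unitaryGroup hQ] at h2
    simp only [p, q] at h1 h2 ⊢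
    linarith

theorem trace_conjTranspose_mul {m n : ℕ} (A B : Matrix (Fin m) (Fin n) ℂ) :
    (A.conjTranspose * B).trace = ∑ i, ∑ j, star (A i j) * B i j := by
  simp only [Matrix.trace, Matrix.diag_apply, Matrix.mul_apply, Matrix.conjTranspose_apply]
  exact Finset.sum_comm

/-- Cyclicity of the trace moves all unitary factors to one side, leaving only the relative
rotations U₁* U₂ and V₁* V₂. -/
theorem trace_svd_mul {m n : ℕ} (U₁ U₂ : Matrix (Fin m) (Fin m) ℂ)
    (V₁ V₂ : Matrix (Fin n) (Fin n) ℂ) (S T : Matrix (Fin m) (Fin n) ℂ) :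
    ((U₁ * S * V₁.conjTranspose).conjTranspose * (U₂ * T * V₂.conjTranspose)).trace =
      (S.conjTranspose *
        (U₁.conjTranspose * U₂ * T * (V₁.conjTranspose * V₂).conjTranspose)).trace := by
  simp only [Matrix.conjTranspose_mul, Matrix.conjTranspose_conjTranspose, Matrix.mul_assoc]
  rw [Matrix.trace_mul_comm]
  simp only [Matrix.mul_assoc]

/-- Von Neumann's trace inequality. -/
theorem IsSVD.re_trace_le {m n : ℕ} {A B : Matrix (Fin m) (Fin n) ℂ}
    {U₁ U₂ : Matrix (Fin m) (Fin m) ℂ} {s t : ℕ → ℝ} {V₁ V₂ : Matrix (Fin n) (Fin n) ℂ}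
    (hA : IsSVD A U₁ s V₁) (hB : IsSVD B U₂ t V₂) :
    (A.conjTranspose * B).trace.re ≤ ∑ i : Fin (min m n), s i * t i := by
  rw [hA.eq_mul, hB.eq_mul, trace_svd_mul]
  exact re_trace_rectDiagonal_le (mul_mem (Unitary.star_mem hA.left_mem) hB.left_mem)
    (mul_mem (Unitary.star_mem hA.right_mem) hB.right_mem) hA.antitone hA.nonneg hB.antitone
    hB.nonneg

/-- The squared Frobenius norm of a complex matrix. -/
noncomputable def normSqSum {m n : ℕ} (A : Matrix (Fin m) (Fin n) ℂ) : ℝ :=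
  ∑ i, ∑ j, Complex.normSq (A i j)

theorem normSqSum_eq_trace {m n : ℕ} (A : Matrix (Fin m) (Fin n) ℂ) :
    (normSqSum A : ℂ) = (A.conjTranspose * A).trace := by
  simp only [normSqSum, trace_conjTranspose_mul, Complex.ofReal_sum, RCLike.star_def,
    Complex.normSq_eq_conj_mul_self]

theorem normSqSum_unitary_mul {m n : ℕ} {U : Matrix (Fin m) (Fin m) ℂ}
    {V : Matrix (Fin n) (Fin n) ℂ} (hU : U ∈ Matrix.unitaryGroup (Fin m) ℂ)
    (hV : V ∈ Matrix.unitaryGroup (Fin n) ℂ) (s : ℕ → ℝ) :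
    normSqSum (U * rectDiagonal ℂ m n s * V.conjTranspose) =
      ∑ i : Fin (min m n), s i ^ 2 := by
  apply Complex.ofReal_injective
  rw [normSqSum_eq_trace, trace_svd_mul, ← Matrix.star_eq_conjTranspose U,
    ← Matrix.star_eq_conjTranspose V, Matrix.mem_unitaryGroup_iff'.1 hU,
    Matrix.mem_unitaryGroup_iff'.1 hV, Matrix.conjTranspose_one, Matrix.one_mul, Matrix.mul_one,
    trace_conjTranspose_mul]
  have h : ∀ a b, star (rectDiagonal ℂ m n s a b) = rectDiagonal ℂ m n s a b := by
    intro a b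
    simp only [rectDiagonal, Matrix.of_apply]
    split_ifs <;> simp
  simp only [h, Complex.ofReal_sum, Complex.ofReal_pow]
  rw [sum_rectDiagonal_mul s fun a b => rectDiagonal ℂ m n s a b]
  exact Finset.sum_congr rfl fun i _ => by simp [rectDiagonal, sq]

theorem normSqSum_sub {m n : ℕ} (A B : Matrix (Fin m) (Fin n) ℂ) :
    normSqSum (A - B) = normSqSum A + normSqSum B - 2 * (A.conjTranspose * B).trace.re := by
  simp only [normSqSum, trace_conjTranspose_mul, Complex.re_sum, Finset.mul_sum,
    ← Finset.sum_add_distrib, ← Finset.sum_sub_distrib]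
  refine Finset.sum_congr rfl fun i _ => Finset.sum_congr rfl fun j _ => ?_
  simp only [Matrix.sub_apply, Complex.normSq_apply, Complex.sub_re, Complex.sub_im,
    Complex.mul_re, RCLike.star_def, Complex.conj_re, Complex.conj_im]
  ring

/-- The Frobenius distance of two matrices is at least the distance of their singular values. -/
theorem IsSVD.sum_sub_sq_le {m n : ℕ} {A B : Matrix (Fin m) (Fin n) ℂ}
    {U₁ U₂ : Matrix (Fin m) (Fin m) ℂ} {s t : ℕ → ℝ} {V₁ V₂ : Matrix (Fin n) (Fin n) ℂ}
    (hA : IsSVD A U₁ s V₁) (hB : IsSVD B U₂ t V₂) :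
    ∑ i : Fin (min m n), (s i - t i) ^ 2 ≤ normSqSum (A - B) := by
  have h1 := normSqSum_unitary_mul hA.left_mem hA.right_mem s
  have h2 := normSqSum_unitary_mul hB.left_mem hB.right_mem t
  rw [← hA.eq_mul] at h1
  rw [← hB.eq_mul] at h2
  have h3 := hA.re_trace_le hB
  rw [normSqSum_sub, h1, h2]
  have h4 : ∑ i : Fin (min m n), (s i - t i) ^ 2 = ∑ i : Fin (min m n), s i ^ 2 +
      ∑ i : Fin (min m n), t i ^ 2 - 2 * ∑ i : Fin (min m n), s i * t i := by
    rw [Finset.mul_sum, ← Finset.sum_add_distrib, ← Finset.sum_sub_distrib]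
    exact Finset.sum_congr rfl fun i _ => by ring
  linarith

/-! ### The derivatives of the penalties -/

/-- The truncated square is differentiable even at its breakpoint. Both penalties are combinations
of such squares on [0, ∞), so their own breakpoints need no separate treatment. -/
theorem hasDerivAt_max_zero_sq (x : ℝ) : HasDerivAt (fun y : ℝ => (max y 0) ^ 2) (2 * max x 0) x := by
  rcases lt_trichotomy x 0 with h | rfl | h
  · have h1 : (fun y : ℝ => (max y 0) ^ 2) =ᶠ[nhds x] fun _ => 0 := by
      filter_upwards [Iio_mem_nhds h] with y hy
      simp [max_eq_right (Set.mem_Iio.1 hy).le]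
    rw [max_eq_right h.le, mul_zero]
    exact (hasDerivAt_const x (0 : ℝ)).congr_of_eventuallyEq h1
  · rw [max_self, mul_zero, hasDerivAt_iff_isLittleO]
    have h1 : (fun y : ℝ => y ^ 2) =o[nhds 0] fun y => y := by
      simpa using Asymptotics.isLittleO_pow_pow (𝕜 := ℝ) (m := 1) (n := 2) one_lt_two
    simp only [max_self, sub_zero, smul_zero, ne_eq, OfNat.ofNat_ne_zero, not_false_eq_true,
      zero_pow]
    refine (Asymptotics.IsBigO.of_bound 1 (Filter.Eventually.of_forall fun y => ?_)).trans_isLittleO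
      h1
    rw [norm_pow, norm_pow, one_mul]
    gcongr
    rcases le_total y 0 with hy | hy <;> simp [hy]
  · have h1 : (fun y : ℝ => (max y 0) ^ 2) =ᶠ[nhds x] fun y => y ^ 2 := by
      filter_upwards [Ioi_mem_nhds h] with y hy
      simp [max_eq_left (Set.mem_Ioi.1 hy).le]
    rw [max_eq_left h.le]
    simpa using (hasDerivAt_pow 2 x).congr_of_eventuallyEq h1

theorem hasDerivAt_max_sub_sq (c t : ℝ) :
    HasDerivAt (fun y : ℝ => (max (c - y) 0) ^ 2) (-(2 * max (c - t) 0)) t := by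
  have h := (hasDerivAt_max_zero_sq (c - t)).comp t ((hasDerivAt_id t).const_sub c)
  simpa [Function.comp_def] using h

theorem phi_scad_eq {γ t : ℝ} (hγ : 1 < γ) (ht : 0 ≤ t) : Penalty.scad.phi 1 γ t =
    (γ + 1) / 2 - ((max (γ - t) 0) ^ 2 - (max (1 - t) 0) ^ 2) / (2 * (γ - 1)) := by
  have h1 : γ - 1 ≠ 0 := by linarith
  simp only [Penalty.phi, abs_of_nonneg ht, mul_one, one_mul, one_pow]
  split_ifs with h2 h3
  · rw [max_eq_left (by linarith), max_eq_left (by linarith)]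
    field_simp
    ring
  · rw [max_eq_left (by linarith), max_eq_right (by linarith)]
    field_simp
    ring
  · rw [max_eq_right (by linarith), max_eq_right (by linarith)]
    simp

theorem phi_mcp_eq {γ t : ℝ} (hγ : 1 < γ) (ht : 0 ≤ t) : Penalty.mcp.phi 1 γ t =
    γ / 2 - (max (γ - t) 0) ^ 2 / (2 * γ) := by
  simp only [Penalty.phi, abs_of_nonneg ht, mul_one, one_mul, one_pow]
  split_ifs with h2
  · rw [max_eq_left (by linarith)]
    field_simp
    ring
  · rw [max_eq_right (by linarith)]
    simp

theorem dphi_scad {γ t : ℝ} (hγ : 1 < γ) (ht : 0 ≤ t) : Penalty.scad.dphi 1 γ t =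
    (max (γ - t) 0 - max (1 - t) 0) / (γ - 1) := by
  have h := ((((hasDerivAt_max_sub_sq γ t).sub (hasDerivAt_max_sub_sq 1 t)).div_const
    (2 * (γ - 1))).const_sub ((γ + 1) / 2)).hasDerivWithinAt (s := Set.Ici 0)
  have h2 := h.congr (f₁ := Penalty.scad.phi 1 γ) (fun x hx => phi_scad_eq hγ hx)
    (phi_scad_eq hγ ht)
  rw [Penalty.dphi, h2.derivWithin (uniqueDiffOn_Ici 0 t ht)]
  have h1 : γ - 1 ≠ 0 := by linarith
  field_simp
  ring

theorem dphi_mcp {γ t : ℝ} (hγ : 1 < γ) (ht : 0 ≤ t) : Penalty.mcp.dphi 1 γ t =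
    max (γ - t) 0 / γ := by
  have h := (((hasDerivAt_max_sub_sq γ t).div_const
    (2 * γ)).const_sub (γ / 2)).hasDerivWithinAt (s := Set.Ici 0)
  have h2 := h.congr (f₁ := Penalty.mcp.phi 1 γ) (fun x hx => phi_mcp_eq hγ hx)
    (phi_mcp_eq hγ ht)
  rw [Penalty.dphi, h2.derivWithin (uniqueDiffOn_Ici 0 t ht)]
  field_simp

theorem dphi_nonneg (P : Penalty) {γ t : ℝ} (hγ : 1 < γ) (ht : 0 ≤ t) : 0 ≤ P.dphi 1 γ t := by
  cases P with
  | scad =>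
    rw [dphi_scad hγ ht]
    refine div_nonneg (sub_nonneg.2 (max_le_max_right _ ?_)) ?_ <;> linarith
  | mcp =>
    rw [dphi_mcp hγ ht]
    positivity

/-- Concavity of the penalty on [0, ∞), the property that keeps thresholded singular values in
order. -/
theorem dphi_antitoneOn (P : Penalty) {γ : ℝ} (hγ : 1 < γ) :
    AntitoneOn (P.dphi 1 γ) (Set.Ici 0) := by
  intro x hx y hy hxy
  cases P with
  | scad =>
    rw [dphi_scad hγ hx, dphi_scad hγ hy]
    refine div_le_div_of_nonneg_right ?_ (by linarith)
    rcases max_cases (γ - x) 0 with h | h <;> rcases max_cases (1 - x) 0 with h' | h' <;>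
    rcases max_cases (γ - y) 0 with g | g <;> rcases max_cases (1 - y) 0 with g' | g' <;> linarith
  | mcp =>
    rw [dphi_mcp hγ hx, dphi_mcp hγ hy]
    gcongr

/-! ### Real tensors in the Fourier domain -/

theorem ext_slice_fft {m n p : ℕ} [NeZero p] {A B : Tensor ℂ m n p}
    (h : ∀ k, slice (fft A) k = slice (fft B) k) : A = B := by
  funext i j
  refine ZMod.dft.injective (funext fun k => ?_)
  exact congrFun (congrFun (h k) i) j

theorem slice_fft_neg {m n p : ℕ} [NeZero p] (A : Tensor ℝ m n p) (k : ZMod p) :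
    slice (fft (toComplex A)) (-k) = (slice (fft (toComplex A)) k).map (starRingEnd ℂ) := by
  ext i j
  simp only [slice, fft, toComplex, ZMod.dft_apply, Matrix.of_apply, Matrix.map_apply, map_sum,
    smul_eq_mul, map_mul, Complex.conj_ofReal, ← AddChar.map_neg_eq_conj, neg_neg, mul_neg]

/-- Converse of `slice_fft_neg`: the symmetry makes the inverse transform equal to its own
conjugate, after reindexing by negation. -/
theorem exists_real_tensor {m n p : ℕ} [NeZero p] {F : ZMod p → Matrix (Fin m) (Fin n) ℂ}
    (hF : ∀ k, F (-k) = (F k).map (starRingEnd ℂ)) :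
    ∃ A : Tensor ℝ m n p, ∀ k, slice (fft (toComplex A)) k = F k := by
  let A : Tensor ℝ m n p := fun i j k => (ZMod.dft.symm (fun l => F l i j) k).re
  have hA : ∀ i j, toComplex A i j = ZMod.dft.symm fun l => F l i j := by
    intro i j
    funext k
    refine Complex.conj_eq_iff_re.1 ?_
    simp only [ZMod.invDFT_apply, smul_eq_mul, map_mul, map_inv₀, Complex.conj_natCast, map_sum,
      ← AddChar.map_neg_eq_conj]
    congr 1
    refine Fintype.sum_equiv (Equiv.neg _) _ _ fun l => ?_
    simp [hF l]
  refine ⟨A, fun k => ?_⟩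
  ext i j
  simp only [slice, fft, hA, Matrix.of_apply, LinearEquiv.apply_symm_apply]

/-- Only the conjugated factor is expanded; the sum over k then becomes Fourier inversion. -/
theorem sum_normSq_dft {p : ℕ} [NeZero p] (f : ZMod p → ℂ) :
    ∑ k, Complex.normSq (ZMod.dft f k) = p * ∑ j, Complex.normSq (f j) := by
  have hp : (p : ℂ) ≠ 0 := NeZero.ne _
  have hinv : ∀ j, ∑ k, ZMod.stdAddChar (k * j) * ZMod.dft f k = p * f j := by
    intro j
    have h := ZMod.invDFT_apply (ZMod.dft f) j
    rw [LinearEquiv.symm_apply_apply, smul_eq_mul] at h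
    simp only [h, smul_eq_mul, mul_inv_cancel_left₀ hp]
  apply Complex.ofReal_injective
  simp only [Complex.ofReal_sum, Complex.ofReal_mul, Complex.ofReal_natCast,
    Complex.normSq_eq_conj_mul_self]
  have h1 : ∀ k, (starRingEnd ℂ) (ZMod.dft f k) * ZMod.dft f k =
      ∑ j, (starRingEnd ℂ) (f j) * (ZMod.stdAddChar (k * j) * ZMod.dft f k) := by
    intro k
    conv_lhs => rw [ZMod.dft_apply, map_sum, Finset.sum_mul, ← ZMod.dft_apply]
    refine Finset.sum_congr rfl fun j _ => ?_
    rw [smul_eq_mul, map_mul, ← AddChar.map_neg_eq_conj, neg_neg, mul_comm j k]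
    ring
  simp only [h1]
  rw [Finset.sum_comm]
  simp only [← Finset.mul_sum, hinv]
  rw [Finset.mul_sum]
  exact Finset.sum_congr rfl fun j _ => by ring

/-- Parseval's identity for tensors. -/
theorem frobenius_sub_sq {m n p : ℕ} [NeZero p] (A B : Tensor ℝ m n p) :
    frobenius (A - B) ^ 2 = 1 / (p : ℝ) *
      ∑ k, normSqSum (slice (fft (toComplex A)) k - slice (fft (toComplex B)) k) := by
  have hp : (p : ℝ) ≠ 0 := NeZero.ne _
  have h1 : ∀ i j, ∑ k, Complex.normSq
      ((slice (fft (toComplex A)) k - slice (fft (toComplex B)) k) i j) =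
      p * ∑ k, |(A - B) i j k| ^ 2 := by
    intro i j
    have h := sum_normSq_dft (toComplex A i j - toComplex B i j)
    rw [map_sub] at h
    simp only [slice, fft, Matrix.sub_apply, Matrix.of_apply]
    simp only [Pi.sub_apply] at h ⊢
    rw [h]
    congr 1
    refine Finset.sum_congr rfl fun k _ => ?_
    rw [sq_abs, toComplex, toComplex, ← Complex.ofReal_sub, Complex.normSq_ofReal, sq]
  rw [frobenius, Real.sq_sqrt (by positivity)]
  simp only [normSqSum]
  have h2 : ∑ k, ∑ i, ∑ j, Complex.normSq
      ((slice (fft (toComplex A)) k - slice (fft (toComplex B)) k) i j) =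
      p * ∑ i, ∑ j, ∑ k, |(A - B) i j k| ^ 2 := by
    rw [Finset.sum_comm, Finset.mul_sum]
    refine Finset.sum_congr rfl fun i _ => ?_
    rw [Finset.sum_comm, Finset.mul_sum]
    exact Finset.sum_congr rfl fun j _ => h1 i j
  rw [h2, one_div, inv_mul_cancel_left₀ hp]

/-! ### Existence of t-SVDs -/

theorem IsTSVD.isSVD {m n p : ℕ} [NeZero p] {A : Tensor ℝ m n p} {U : Tensor ℝ m m p}
    {S : Tensor ℝ m n p} {V : Tensor ℝ n n p} (h : IsTSVD A U S V) (k : ZMod p) :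
    slice (fft (toComplex S)) k = rectDiagonal ℂ m n (fun i => fourierSV A i k) ∧
    IsSVD (slice (fft (toComplex A)) k) (slice (fft (toComplex U)) k) (fun i => fourierSV A i k)
      (slice (fft (toComplex V)) k) := by
  have hS : slice (fft (toComplex S)) k = rectDiagonal ℂ m n (fun i => fourierSV A i k) := by
    ext ⟨a, ha⟩ ⟨b, hb⟩
    simp only [rectDiagonal, Matrix.of_apply]
    split_ifs with hab
    · subst hab
      exact h.fourierDiag_eq ⟨a, lt_min ha hb⟩ k
    · have h0 : toComplex S ⟨a, ha⟩ ⟨b, hb⟩ = 0 := by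
        funext l
        simp [toComplex, h.fDiagonal ⟨a, ha⟩ ⟨b, hb⟩ l hab]
      simp [slice, fft, h0]
  refine ⟨hS, ?_, ?_, ?_, ?_, ?_⟩
  · rw [Matrix.mem_unitaryGroup_iff, Matrix.star_eq_conjTranspose, ← slice_fft_conjT,
      ← slice_fft_tprod, h.orthogonal_left.1, slice_fft_identity]
  · rw [Matrix.mem_unitaryGroup_iff, Matrix.star_eq_conjTranspose, ← slice_fft_conjT,
      ← slice_fft_tprod, h.orthogonal_right.1, slice_fft_identity]
  · exact LinearMap.singularValues_antitone _
  · exact LinearMap.singularValues_nonneg _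
  · rw [h.factorization, slice_fft_tprod, slice_fft_tprod, slice_fft_conjT, hS]

theorem isOrthogonal_of_slice_mem {n p : ℕ} [NeZero p] {Q : Tensor ℝ n n p}
    (h : ∀ k, slice (fft (toComplex Q)) k ∈ Matrix.unitaryGroup (Fin n) ℂ) : IsOrthogonal Q := by
  constructor <;> refine ext_slice_fft fun k => ?_ <;>
    rw [slice_fft_tprod, slice_fft_conjT, slice_fft_identity, ← Matrix.star_eq_conjTranspose]
  exacts [Matrix.mem_unitaryGroup_iff.1 (h k), Matrix.mem_unitaryGroup_iff'.1 (h k)]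

/-- Converse of `IsTSVD.isSVD`. The second conclusion identifies the singular values of a tensor
built from prescribed slicewise decompositions. -/
theorem isTSVD_of_isSVD {m n p : ℕ} [NeZero p] {A : Tensor ℝ m n p} {U : Tensor ℝ m m p}
    {S : Tensor ℝ m n p} {V : Tensor ℝ n n p} {s : ZMod p → ℕ → ℝ}
    (hS : ∀ k, slice (fft (toComplex S)) k = rectDiagonal ℂ m n (s k))
    (h : ∀ k, IsSVD (slice (fft (toComplex A)) k) (slice (fft (toComplex U)) k) (s k)
      (slice (fft (toComplex V)) k)) :
    IsTSVD A U S V ∧ ∀ (i : Fin (min m n)) k, fourierSV A i k = s k i := by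
  have hdiag : ∀ i k, fourierDiag S i k = (s k i : ℂ) := by
    intro i k
    have h1 := congrFun (congrFun (hS k) (Fin.castLE (min_le_left m n) i))
      (Fin.castLE (min_le_right m n) i)
    simpa [rectDiagonal, slice, fourierDiag] using h1
  have hT : IsTSVD A U S V :=
    { orthogonal_left := isOrthogonal_of_slice_mem fun k => (h k).left_mem
      orthogonal_right := isOrthogonal_of_slice_mem fun k => (h k).right_mem
      fDiagonal := by
        intro i j k hij
        have h0 : toComplex S i j = 0 := by
          refine ZMod.dft.injective (funext fun l => ?_)
          have h1 := congrFun (congrFun (hS l) i) j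
          simpa [rectDiagonal, slice, fft, hij] using h1
        simpa [toComplex] using congrFun h0 k
      factorization := by
        refine ext_slice_fft fun k => ?_
        rw [slice_fft_tprod, slice_fft_tprod, slice_fft_conjT, hS, (h k).eq_mul]
      real := fun i k => by simp [hdiag]
      nonneg := fun i k => by simpa [hdiag] using (h k).nonneg i
      decreasing := fun k i j hij => by simpa [hdiag] using (h k).antitone hij }
  refine ⟨hT, fun i k => ?_⟩
  have h1 := hT.fourierDiag_eq i k
  rw [hdiag] at h1
  exact_mod_cast h1.symm

/-- Equivariant choice for the involution `k ↦ -k` of `ZMod p`. -/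
theorem exists_equivariant {p : ℕ} [NeZero p] {α : Type*} {R : ZMod p → α → Prop} {c : α → α}
    (hc : ∀ x, c (c x) = x) (hRc : ∀ k x, R k x → R (-k) (c x)) (hR : ∀ k, ∃ x, R k x)
    (hR' : ∀ k, -k = k → ∃ x, R k x ∧ c x = x) :
    ∃ f : ZMod p → α, ∀ k, R k (f k) ∧ f (-k) = c (f k) := by
  have h : ∀ k, ∃ x, R k x ∧ (-k = k → c x = x) := by
    intro k
    by_cases hk : -k = k
    · obtain ⟨x, hx, hx'⟩ := hR' k hk
      exact ⟨x, hx, fun _ => hx'⟩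
    · obtain ⟨x, hx⟩ := hR k
      exact ⟨x, hx, fun h => absurd h hk⟩
  choose g hg hg' using h
  -- In each pair {k, -k} the member with the smaller representative decides, and the other gets the
  -- `c`-image.
  refine ⟨fun k => if k.val ≤ (-k).val then g k else c (g (-k)), fun k => ⟨?_, ?_⟩⟩
  · dsimp only
    split_ifs
    · exact hg k
    · simpa using hRc _ _ (hg (-k))
  · simp only [neg_neg]
    by_cases hk : -k = k
    · simp only [hk, le_refl, if_true, hg' k hk]
    · have hne : (-k).val ≠ k.val := fun h => hk (ZMod.val_injective p h)
      by_cases h1 : k.val ≤ (-k).val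
      · rw [if_pos h1, if_neg (by omega)]
      · rw [if_neg h1, if_pos (by omega), hc]

theorem map_starRingEnd_map_starRingEnd {m n : ℕ} (A : Matrix (Fin m) (Fin n) ℂ) :
    (A.map (starRingEnd ℂ)).map (starRingEnd ℂ) = A := by
  ext i j
  simp

theorem rectDiagonal_map_conj (m n : ℕ) (s : ℕ → ℝ) :
    (rectDiagonal ℂ m n s).map (starRingEnd ℂ) = rectDiagonal ℂ m n s := by
  ext i j
  simp only [rectDiagonal, Matrix.map_apply, Matrix.of_apply]
  split_ifs <;> simp

theorem exists_isTSVD {m n p : ℕ} [NeZero p] (A : Tensor ℝ m n p) :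
    ∃ U S V, IsTSVD A U S V := by
  obtain ⟨f, hf⟩ := exists_equivariant (p := p)
    (R := fun k (x : Matrix (Fin m) (Fin m) ℂ × (ℕ → ℝ) × Matrix (Fin n) (Fin n) ℂ) =>
      IsSVD (slice (fft (toComplex A)) k) x.1 x.2.1 x.2.2)
    (c := fun x => (x.1.map (starRingEnd ℂ), x.2.1, x.2.2.map (starRingEnd ℂ)))
    (fun x => by simp only [map_starRingEnd_map_starRingEnd])
    (fun k x hx => by
      rw [slice_fft_neg]
      exact hx.map (fun _ => by simp) (fun r => Complex.conj_ofReal r))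
    (fun k => by
      obtain ⟨U, s, V, h⟩ := exists_isSVD (slice (fft (toComplex A)) k)
      exact ⟨(U, s, V), h⟩)
    (fun k hk => by
      -- At a self-conjugate frequency the slice is real, so it has a real decomposition, which
      -- conjugation fixes.
      have hreal : slice (fft (toComplex A)) k =
          ((slice (fft (toComplex A)) k).map Complex.re).map Complex.ofRealHom := by
        ext i j
        have h1 := congrFun (congrFun (slice_fft_neg A k) i) j
        rw [hk] at h1
        exact (Complex.conj_eq_iff_re.1 h1.symm).symm
      obtain ⟨U, s, V, h⟩ := exists_isSVD ((slice (fft (toComplex A)) k).map Complex.re)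
      refine ⟨(U.map Complex.ofRealHom, s, V.map Complex.ofRealHom), ?_, ?_⟩
      · rw [hreal]
        exact h.map (fun _ => by simp) (fun _ => by simp)
      · refine Prod.ext ?_ (Prod.ext rfl ?_) <;> ext i j <;> simp)
  obtain ⟨U, hU⟩ := exists_real_tensor (F := fun k => (f k).1) fun k => by rw [(hf k).2]
  obtain ⟨V, hV⟩ := exists_real_tensor (F := fun k => (f k).2.2) fun k => by rw [(hf k).2]
  obtain ⟨S, hS⟩ := exists_real_tensor (F := fun k => rectDiagonal ℂ m n (f k).2.1) fun k => by
    rw [(hf k).2, rectDiagonal_map_conj]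
  refine ⟨U, S, V, (isTSVD_of_isSVD hS fun k => ?_).1⟩
  rw [hU, hV]
  exact (hf k).1

theorem fourierSV_neg {m n p : ℕ} [NeZero p] (A : Tensor ℝ m n p) (i : Fin (min m n))
    (k : ZMod p) : fourierSV A i (-k) = fourierSV A i k := by
  obtain ⟨U, S, V, h⟩ := exists_isTSVD A
  have h1 := congrFun (congrFun (slice_fft_neg S k) (Fin.castLE (min_le_left m n) i))
      (Fin.castLE (min_le_right m n) i)
  have h2 : fourierDiag S i (-k) = (starRingEnd ℂ) (fourierDiag S i k) := h1
  rw [h.fourierDiag_eq, h.fourierDiag_eq, Complex.conj_ofReal] at h2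
  exact_mod_cast h2

/-! ### The generalized t-SVT -/

theorem softThreshold_of_nonneg {w z : ℝ} (hw : 0 ≤ w) (hz : 0 ≤ z) :
    softThreshold w z = max (z - w) 0 := by
  rw [softThreshold, abs_of_nonneg hz]
  rcases hz.eq_or_lt with rfl | hz
  · simp [hw]
  · rw [Real.sign_of_pos hz, one_mul]

/-- The scalar problem solved by soft thresholding. -/
theorem max_sub_isMin {w x y : ℝ} (hx : 0 ≤ x) :
    w * max (y - w) 0 + 1 / 2 * (max (y - w) 0 - y) ^ 2 ≤ w * x + 1 / 2 * (x - y) ^ 2 := by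
  rcases le_total w y with h | h
  · rw [max_eq_left (by linarith)]
    -- The two sides differ by (x - y + w)²/2; in the other case by x (w - y) + x²/2.
    nlinarith [sq_nonneg (x - y + w)]
  · rw [max_eq_right (by linarith)]
    nlinarith [mul_nonneg hx (sub_nonneg.2 h), sq_nonneg x]

theorem rectDiagonal_congr {m n : ℕ} {s t : ℕ → ℝ} (h : ∀ i : Fin (min m n), s i = t i) :
    rectDiagonal ℂ m n s = rectDiagonal ℂ m n t := by
  ext i j
  simp only [rectDiagonal, Matrix.of_apply]
  split_ifs with hij
  · have := h ⟨i, lt_min i.2 (hij ▸ j.2)⟩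
    simp only at this
    rw [this]
  · rfl

theorem rectDiagonal_sub (m n : ℕ) (s t : ℕ → ℝ) :
    rectDiagonal ℂ m n s - rectDiagonal ℂ m n t = rectDiagonal ℂ m n fun i => s i - t i := by
  ext i j
  simp only [rectDiagonal, Matrix.sub_apply, Matrix.of_apply]
  split_ifs <;> simp

theorem slice_fft_generalizedTSVT {m n p : ℕ} [NeZero p] {Y : Tensor ℝ m n p} {U : Tensor ℝ m m p}
    {S : Tensor ℝ m n p} {V : Tensor ℝ n n p} (h : IsTSVD Y U S V) {w : ZMod p → ℕ → ℝ}
    (hw : ∀ k i, 0 ≤ w k i) (k : ZMod p) :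
    slice (fft (generalizedTSVT (fun i j k => if (i : ℕ) = (j : ℕ) then w k i else 0) U S V)) k =
      slice (fft (toComplex U)) k *
        rectDiagonal ℂ m n (fun i => max (fourierSV Y i k - w k i) 0) *
        (slice (fft (toComplex V)) k).conjTranspose := by
  rw [generalizedTSVT, slice_fft_tprod, slice_fft_tprod, slice_fft_conjT]
  congr 2
  ext i j
  have h1 : fft (toComplex S) i j k = rectDiagonal ℂ m n (fun i => fourierSV Y i k) i j :=
    congrFun (congrFun (h.isSVD k).1 i) j
  simp only [slice, fft, ifft, Matrix.of_apply, LinearEquiv.apply_symm_apply, toComplex,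
    softThresholdTensor]
  simp only [fft] at h1
  rw [h1]
  simp only [rectDiagonal, Matrix.of_apply]
  split_ifs
  · exact congrArg _ (softThreshold_of_nonneg (hw k i) (LinearMap.singularValues_nonneg _ _))
  · simp [softThreshold]

/-- `hmono` keeps the thresholded values nonincreasing, so `U` and `V` give a decomposition of `D`
without reordering. With the factors shared with `Y`, the lower bound on the distance becomes an
equality. `hneg` makes `D` real. -/
theorem exists_real_generalizedTSVT {m n p : ℕ} [NeZero p] {Y : Tensor ℝ m n p}
    {U : Tensor ℝ m m p} {S : Tensor ℝ m n p} {V : Tensor ℝ n n p} (h : IsTSVD Y U S V)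
    {w : ZMod p → ℕ → ℝ} (hw : ∀ k i, 0 ≤ w k i) (hmono : ∀ k, Monotone (w k))
    (hneg : ∀ k (i : Fin (min m n)), w (-k) i = w k i) :
    ∃ D : Tensor ℝ m n p,
      toComplex D =
        generalizedTSVT (fun i j k => if (i : ℕ) = (j : ℕ) then w k i else 0) U S V ∧
      (∀ (i : Fin (min m n)) k, fourierSV D i k = max (fourierSV Y i k - w k i) 0) ∧
      ∀ k, normSqSum (slice (fft (toComplex D)) k - slice (fft (toComplex Y)) k) =
        ∑ i : Fin (min m n), (fourierSV D i k - fourierSV Y i k) ^ 2 := by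
  let d : ZMod p → ℕ → ℝ := fun k i => max (fourierSV Y i k - w k i) 0
  -- Symmetry of the weights is known only for indices below `min m n`, so the matrices are
  -- compared, not the sequences.
  have hd : ∀ k, rectDiagonal ℂ m n (d (-k)) = rectDiagonal ℂ m n (d k) := fun k =>
    rectDiagonal_congr fun i => by simp only [d, fourierSV_neg, hneg]
  obtain ⟨T, hT⟩ := exists_real_tensor (F := fun k => rectDiagonal ℂ m n (d k)) fun k => by
    rw [hd, rectDiagonal_map_conj]
  obtain ⟨D, hD⟩ := exists_real_tensor (F := fun k => slice (fft (toComplex U)) k *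
    rectDiagonal ℂ m n (d k) * (slice (fft (toComplex V)) k).conjTranspose) fun k => by
      rw [hd, slice_fft_neg, slice_fft_neg, Matrix.map_mul, Matrix.map_mul, rectDiagonal_map_conj,
        Matrix.conjTranspose_map _ fun _ => by simp]
  have hsvd : ∀ k, IsSVD (slice (fft (toComplex D)) k) (slice (fft (toComplex U)) k) (d k)
      (slice (fft (toComplex V)) k) := fun k =>
    { left_mem := (h.isSVD k).2.left_mem
      right_mem := (h.isSVD k).2.right_mem
      antitone := fun i j hij => max_le_max_right _
        (sub_le_sub ((h.isSVD k).2.antitone hij) (hmono k hij))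
      nonneg := fun i => le_max_right _ _
      eq_mul := hD k }
  have hsv := (isTSVD_of_isSVD hT hsvd).2
  refine ⟨D, ext_slice_fft fun k => ?_, hsv, fun k => ?_⟩
  · rw [hD, slice_fft_generalizedTSVT h hw]
  · rw [(hsvd k).eq_mul, (h.isSVD k).2.eq_mul, ← Matrix.sub_mul, ← Matrix.mul_sub,
      rectDiagonal_sub, normSqSum_unitary_mul (h.isSVD k).2.left_mem (h.isSVD k).2.right_mem]
    exact Finset.sum_congr rfl fun i _ => by rw [hsv]

theorem sum_sub_sq_le_normSqSum {m n p : ℕ} [NeZero p] (X Y : Tensor ℝ m n p) (k : ZMod p) :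
    ∑ i : Fin (min m n), (fourierSV X i k - fourierSV Y i k) ^ 2 ≤
      normSqSum (slice (fft (toComplex X)) k - slice (fft (toComplex Y)) k) := by
  obtain ⟨_, _, _, hX⟩ := exists_isTSVD X
  obtain ⟨_, _, _, hY⟩ := exists_isTSVD Y
  exact (hX.isSVD k).2.sum_sub_sq_le (hY.isSVD k).2

theorem majorant_add_frobenius_le {m n p : ℕ} [NeZero p] (P : Penalty) {γ μ : ℝ} (hμ : 0 < μ)
    {Xold X D Y : Tensor ℝ m n p}
    (hD : ∀ (i : Fin (min m n)) k, fourierSV D i k =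
      max (fourierSV Y i k - P.dphi 1 γ (fourierSV Xold i k) / μ) 0)
    (hDY : ∀ k, normSqSum (slice (fft (toComplex D)) k - slice (fft (toComplex Y)) k) =
      ∑ i : Fin (min m n), (fourierSV D i k - fourierSV Y i k) ^ 2) :
    majorant P γ D Xold + μ / 2 * frobenius (D - Y) ^ 2 ≤
      majorant P γ X Xold + μ / 2 * frobenius (X - Y) ^ 2 := by
  rw [majorant, majorant, frobenius_sub_sq, frobenius_sub_sq, add_assoc, add_assoc]
  refine add_le_add_right ?_ _
  rw [mul_left_comm (μ / 2), mul_left_comm (μ / 2), ← mul_add, ← mul_add]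
  refine mul_le_mul_of_nonneg_left ?_ (by positivity)
  rw [Finset.sum_comm, Finset.sum_comm (s := (Finset.univ : Finset (Fin (min m n)))),
    Finset.mul_sum, Finset.mul_sum, ← Finset.sum_add_distrib, ← Finset.sum_add_distrib]
  refine Finset.sum_le_sum fun k _ => ?_
  refine le_trans ?_ (add_le_add_right (mul_le_mul_of_nonneg_left
    (sum_sub_sq_le_normSqSum X Y k) (by positivity)) _)
  rw [hDY, Finset.mul_sum, Finset.mul_sum, ← Finset.sum_add_distrib, ← Finset.sum_add_distrib]
  refine Finset.sum_le_sum fun i _ => ?_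
  -- Multiplying the scalar inequality by μ turns the threshold back into the majorant's
  -- coefficient.
  have h := mul_le_mul_of_nonneg_left (max_sub_isMin (w := P.dphi 1 γ (fourierSV Xold i k) / μ)
    (y := fourierSV Y i k) (x := fourierSV X i k) (LinearMap.singularValues_nonneg _ _)) hμ.le
  rw [← hD] at h
  have h2 : μ * (P.dphi 1 γ (fourierSV Xold i k) / μ) = P.dphi 1 γ (fourierSV Xold i k) :=
    mul_div_cancel₀ _ hμ.ne'
  rw [mul_add, mul_add, ← mul_assoc, ← mul_assoc μ _ (fourierSV X i k), h2] at h
  linarith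

end TensorSVT

theorem mainTheorem1 {n₁ n₂ n₃ : ℕ} [NeZero n₃] (P : TensorSVT.Penalty) (γ μ : ℝ)
    (hγ : 1 < γ) (hμ : 0 < μ) (Xold Y : TensorSVT.Tensor ℝ n₁ n₂ n₃) :
    (∃ U S V, TensorSVT.IsTSVD Y U S V) ∧
      ∀ U S V, TensorSVT.IsTSVD Y U S V →
        ∃ D : TensorSVT.Tensor ℝ n₁ n₂ n₃,
          TensorSVT.toComplex D =
              TensorSVT.generalizedTSVT (TensorSVT.svtWeight P γ μ Xold) U S V ∧
            IsMinOn
              (fun X : TensorSVT.Tensor ℝ n₁ n₂ n₃ =>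
                TensorSVT.majorant P γ X Xold + μ / 2 * TensorSVT.frobenius (X - Y) ^ 2)
              Set.univ D := by
  refine ⟨TensorSVT.exists_isTSVD Y, fun U S V h => ?_⟩
  have hsv : ∀ i k, 0 ≤ TensorSVT.fourierSV Xold i k := fun _ _ =>
    LinearMap.singularValues_nonneg _ _
  obtain ⟨D, hD, hsvD, hDY⟩ := TensorSVT.exists_real_generalizedTSVT h
    (w := fun k i => P.dphi 1 γ (TensorSVT.fourierSV Xold i k) / μ)
    (fun k i => div_nonneg (TensorSVT.dphi_nonneg P hγ (hsv i k)) hμ.le)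
    -- Two order reversals: singular values decrease in the index, and the derivative of the penalty
    -- decreases in its argument.
    (fun k i j hij => div_le_div_of_nonneg_right (TensorSVT.dphi_antitoneOn P hγ (hsv j k)
      (hsv i k) (LinearMap.singularValues_antitone _ hij)) hμ.le)
    (fun k i => by simp only [TensorSVT.fourierSV_neg])
  exact ⟨D, hD, fun X _ => TensorSVT.majorant_add_frobenius_le P hμ hsvD hDY⟩
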